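/- **Setting.** Let $n,L\ge 1$ and $n_0\ge 0$ be integers. We observe a random tensor $B\in\{0,1\}^{n\times n\times L}$ with $B_{i,j,l}=B_{j,i,l}$ and $B_{i,i,l}=0$, whose entries with $i<j$ are independent Bernoulli variables with $\mathbb P(B_{i,j,l}=1)=\Lambda^*_{i,j,l}$. In the dynamic stochastic block model (DSBM) with $m^*$ classes, at each time $l=1,\dots,L$ every node belongs to one of $m^*$ classes, and for $i\ne j$ one has $\Lambda^*_{i,j,l}=Q^*_{k,l}$, where $k$ is the unordered pair of the classes of $i$ and $j$ at time $l$ and $Q^*\in[0,1]^{M^*\times L}$, $M^*=m^*(m^*+1)/2$; also $\Lambda^*_{i,i,l}=0$. Let $H\in\mathbb R^{L\times L}$ be orthogonal and $D^*=Q^*H^T$. For each $m$, let $\mathcal Z(m)$ be the set of assignments of the $n$ nodes to $m$ classes at times $1,\dots,L$ for which at most $n_0$ nodes change their class between any two consecutive times, and, for constants $0<\aleph_1\le1\le\aleph_2<\infty$, let $\mathcal Z_{bal}(m)\subseteq\mathcal Z(m)$ be the subset of those for which every class has at every time between $\aleph_1 n/m$ and $\aleph_2 n/m$ nodes. For $M=m(m+1)/2$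 and an assignment in $\mathcal Z(m)$, let $C$ be the block diagonal $\frac{n(n-1)}2L\times ML$ matrix whose $l$-th diagonal block has a 1 at the row of nodes $(i_1,i_2)$, $i_1<i_2$, and the column of the unordered pair of classes $\{k_1,k_2\}$ if one of the nodes is in class $k_1$ and the other one in class $k_2$ at time $l$, and a 0 otherwise. Let $W=H\otimes I_M$, let $a$ be the vector of the $B_{i,j,l}$ with $i<j$, and put $$\mathrm{Pen}(|J|,m)=11\Big[n\log m+n_0(L-1)\log\Big(\frac{mne}{n_0}\Big)+\frac{|J|}2\log\Big(\frac{25m^2L}{|J|}\Big)\Big],$$ where the second term is $0$ if $n_0=0$ and the last one is $0$ if $|J|=0$. For each $m$ let $\mathcal C(m)$ be a set of clusterings with $\mathcal Z_{bal}(m)\subseteq\mathcal C(m)\subseteq\mathcal Z(m)$ (for instance one of these two sets). The estimator takes any solution $$(\hat m,\hat J,\hat d,\hat C)\in\operatorname*{argmin}_{m,J,d,C}\big[\|a-CW^Td\|^2+\mathrm{Pen}(|J|,m)\big],\qquad d_{J^c}=0,$$ over $1\le m\le n$, clusterings in $\mathcal C(m)$ with matrix $C$, sets $J$ of index pairs $(k,l)$,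 $1\le k\le M$, $1\le l\le L$, and $d\in\mathbb R^{ML}$. Then $\hat\Lambda$ is the tensor, symmetric in its first two indices and zero for $i=j$, whose entries with $i<j$ form the vector $\hat C\hat W^T\hat d$, where $\hat W=H\otimes I_{\hat m(\hat m+1)/2}$. Write $\|\Lambda\|^2=\sum_{i,j,l}\Lambda_{i,j,l}^2$. **Theorem.** Suppose that the true clustering belongs to $\mathcal Z_{bal}(m^*)$ and that $n\ge\sqrt{e\,n_0^3}$. Then, for any $t>0$, with probability at least $1-9e^{-t}$, $$\frac{\|\hat\Lambda-\Lambda^*\|^2}{n^2L}\le\min_J\Big\{\frac{6\aleph_2^2}{(m^*)^2L}\sum_{k=1}^{M^*}\sum_{l\notin J_k}(D^*_{k,l})^2+\frac{4\,\mathrm{Pen}(|J|,m^*)}{n^2L}\Big\}+\frac{38\,t}{n^2L},$$ and $$\mathbb E\,\frac{\|\hat\Lambda-\Lambda^*\|^2}{n^2L}\le\min_J\Big\{\frac{6\aleph_2^2}{(m^*)^2L}\sum_{k=1}^{M^*}\sum_{l\notin J_k}(D^*_{k,l})^2+\frac{4\,\mathrm{Pen}(|J|,m^*)}{n^2L}\Big\}+\frac{342}{n^2L}.$$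 The minima are over all families of rowwise sets $J_k\subseteq\{1,\dots,L\}$, $k=1,\dots,M^*$; $J$ is their union as a set of entries $(k,l)$ of an $M^*\times L$ matrix, so that $|J|=\sum_k|J_k|$. -/

import Mathlib

open MeasureTheory ProbabilityTheory
open scoped Kronecker

namespace DSBM

noncomputable section

/-- Pairs of nodes `i₁ < i₂`; there are `n (n - 1) / 2` of them. -/
abbrev NodePair (n : ℕ) : Type := {p : Fin n × Fin n // p.1 < p.2}

/-- Unordered pairs of classes, a class with itself included; there are `m (m + 1) / 2` of them. -/
abbrev ClassPair (m : ℕ) : Type := Sym2 (Fin m)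

/-- A sequence of `L` clustering (membership) matrices of `n` nodes into `m` classes. A 0-1 matrix
with exactly one 1 in each row is the same thing as a map sending each node to its class, so
`z l i` is the class of the node `i` at the time instant `l`. -/
abbrev Clustering (m n L : ℕ) : Type := Fin L → Fin n → Fin m

/-- The number of nodes in class `k` at the time instant `l`. -/
def classSize {m n L : ℕ} (z : Clustering m n L) (l : Fin L) (k : Fin m) : ℕ :=
  (Finset.univ.filter fun i : Fin n => z l i = k).card

/-- Clusterings such that at most `n₀` nodes change their class between two consecutive time
instants. -/
def clusterings (m n n₀ L : ℕ) : Set (Clustering m n L) :=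
  {z | ∀ l l' : Fin L, (l' : ℕ) = l + 1 →
    (Finset.univ.filter fun i : Fin n => z l i ≠ z l' i).card ≤ n₀}

/-- The balance condition: all class sizes at all times are between `α₁ n / m` and `α₂ n / m`. -/
def IsBalanced {m n L : ℕ} (α₁ α₂ : ℝ) (z : Clustering m n L) : Prop :=
  ∀ (l : Fin L) (k : Fin m),
    α₁ * ((n : ℝ) / m) ≤ classSize z l k ∧ (classSize z l k : ℝ) ≤ α₂ * ((n : ℝ) / m)

/-- Balanced clusterings with at most `n₀` changes between consecutive time instants. -/
def balancedClusterings (m n n₀ L : ℕ) (α₁ α₂ : ℝ) : Set (Clustering m n L) :=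
  {z | z ∈ clusterings m n n₀ L ∧ IsBalanced α₁ α₂ z}

/-- The block diagonal matrix `C`. Its `l`-th diagonal block is the clustering matrix of pairs of
nodes: the entry at `(i₁, i₂)` and `(k₁, k₂)` is 1 if one of the two nodes is in class `k₁` and
the other is in class `k₂` at time `l`, and 0 otherwise. -/
def pairMatrix {m n L : ℕ} (z : Clustering m n L) :
    Matrix (Fin L × NodePair n) (Fin L × ClassPair m) ℝ :=
  Matrix.of fun p c =>
    if p.1 = c.1 ∧ s(z p.1 p.2.1.1, z p.1 p.2.1.2) = c.2 then 1 else 0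

/-- The matrix `W = H ⊗ I_M`. -/
def transformMatrix {L : ℕ} (m : ℕ) (H : Matrix (Fin L) (Fin L) ℝ) :
    Matrix (Fin L × ClassPair m) (Fin L × ClassPair m) ℝ :=
  H ⊗ₖ (1 : Matrix (ClassPair m) (ClassPair m) ℝ)

/-- Tensors with two node indices and one time index. -/
abbrev Tensor (n L : ℕ) : Type := Fin n → Fin n → Fin L → ℝ

/-- Adjacency tensors: 0-1 valued, symmetric in the nodes, zero on the diagonal. -/
def IsAdjacency {n L : ℕ} (b : Tensor n L) : Prop :=
  (∀ i j l, b i j l = 0 ∨ b i j l = 1) ∧ (∀ i j l, b i j l = b j i l) ∧ ∀ i l, b i i l = 0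

/-- The vector of the entries of a tensor with `i₁ < i₂`. -/
def unpack {n L : ℕ} (b : Tensor n L) : Fin L × NodePair n → ℝ :=
  fun p => b p.2.1.1 p.2.1.2 p.1

/-- The symmetric tensor with zero diagonal that has the given entries for `i₁ < i₂`. -/
def pack {n L : ℕ} (θ : Fin L × NodePair n → ℝ) : Tensor n L := fun i j l =>
  if h : i < j then θ (l, ⟨(i, j), h⟩) else if h : j < i then θ (l, ⟨(j, i), h⟩) else 0

/-- The squared Frobenius norm of a tensor. -/
def normSq {n L : ℕ} (x : Tensor n L) : ℝ := ∑ i, ∑ j, ∑ l, x i j l ^ 2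

/-- The tensor of connection probabilities of the dynamic stochastic block model: two different
nodes that are in the classes `k₁` and `k₂` at time `l` are connected with probability
`Q {k₁, k₂} l`; there are no self-loops. -/
def probTensor {m n L : ℕ} (z : Clustering m n L) (Q : Matrix (ClassPair m) (Fin L) ℝ) :
    Tensor n L := fun i j l => if i = j then 0 else Q s(z l i, z l j) l

/-- `B` is a random adjacency tensor whose entries with `i < j` are independent Bernoulli
variables with success probabilities given by the tensor `Λ`. -/
structure IsObservation {Ω : Type*} [MeasurableSpace Ω] (P : Measure Ω) {n L : ℕ}
    (Λ : Tensor n L) (B : Ω → Tensor n L) : Prop where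
  measurable : ∀ i j l, Measurable fun ω => B ω i j l
  adjacency : ∀ ω, IsAdjacency (B ω)
  prob : ∀ i j l, P.real {ω | B ω i j l = 1} = Λ i j l
  indep : iIndepFun (fun (p : Fin L × NodePair n) (ω : Ω) => unpack (B ω) p) P

/-- The penalty, as a function of the cardinality `j` of the set of retained coefficients and of
the number `m` of classes. For `n₀ = 0` or `j = 0` the respective term is zero. -/
def penalty (n n₀ L j m : ℕ) : ℝ :=
  11 * ((n : ℝ) * Real.log m
    + (n₀ : ℝ) * ((L : ℝ) - 1) * Real.log ((m : ℝ) * n * Real.exp 1 / n₀)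
    + (j : ℝ) / 2 * Real.log (25 * (m : ℝ) ^ 2 * L / j))

/-- A tuple `(m, C, J, d)` over which the optimization is carried out. -/
structure Candidate (n L : ℕ) where
  /-- the number of classes -/
  m : ℕ
  /-- the clustering -/
  z : Clustering m n L
  /-- the set of retained coefficients -/
  J : Finset (Fin L × ClassPair m)
  /-- the vector of coefficients -/
  d : Fin L × ClassPair m → ℝ

/-- The vector `θ = C Wᵀ d` of a candidate. -/
def Candidate.theta {n L : ℕ} (e : Candidate n L) (H : Matrix (Fin L) (Fin L) ℝ) :
    Fin L × NodePair n → ℝ :=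
  (pairMatrix e.z * (transformMatrix e.m H).transpose).mulVec e.d

/-- The constraints: `1 ≤ m ≤ n`, the clustering belongs to the class `𝒞 m`, and `d` vanishes
outside of `J`. -/
def Candidate.IsAdmissible {n L : ℕ} (𝒞 : (m : ℕ) → Set (Clustering m n L))
    (e : Candidate n L) : Prop :=
  1 ≤ e.m ∧ e.m ≤ n ∧ e.z ∈ 𝒞 e.m ∧ ∀ j, j ∉ e.J → e.d j = 0

/-- The penalized least squares criterion `‖a - C Wᵀ d‖² + Pen(|J|, m)`. -/
def Candidate.objective {n L : ℕ} (n₀ : ℕ) (H : Matrix (Fin L) (Fin L) ℝ) (b : Tensor n L)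
    (e : Candidate n L) : ℝ :=
  (∑ p, (unpack b p - e.theta H p) ^ 2) + penalty n n₀ L e.J.card e.m

/-- `e` solves the optimization problem for the data `b`. -/
def Candidate.IsSolution {n L : ℕ} (n₀ : ℕ) (H : Matrix (Fin L) (Fin L) ℝ)
    (𝒞 : (m : ℕ) → Set (Clustering m n L)) (b : Tensor n L) (e : Candidate n L) : Prop :=
  e.IsAdmissible 𝒞 ∧
    ∀ e' : Candidate n L, e'.IsAdmissible 𝒞 → e.objective n₀ H b ≤ e'.objective n₀ H b

/-- The estimated tensor of connection probabilities. -/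
def Candidate.tensor {n L : ℕ} (e : Candidate n L) (H : Matrix (Fin L) (Fin L) ℝ) : Tensor n L :=
  pack (e.theta H)

/-- The normalized squared error `‖Λ' - Λ‖² / (n² L)`. -/
def loss {n L : ℕ} (Λ' Λ : Tensor n L) : ℝ :=
  normSq (fun i j l => Λ' i j l - Λ i j l) / ((n : ℝ) ^ 2 * L)

/-- The set `J` of entries of an `M × L` matrix that is the union of the rowwise sets `J_k`. -/
def rowUnion {m L : ℕ} (J : ClassPair m → Finset (Fin L)) : Finset (Fin L × ClassPair m) :=
  Finset.univ.filter fun j => j.1 ∈ J j.2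

/-- The minimum, over the rowwise sets `J_k`, of the sum of the bias and penalty terms. -/
def oracleBound (n n₀ : ℕ) {m L : ℕ} (α₂ : ℝ) (D : Matrix (ClassPair m) (Fin L) ℝ) : ℝ :=
  ⨅ J : ClassPair m → Finset (Fin L),
    (6 * α₂ ^ 2 / ((m : ℝ) ^ 2 * L) * ∑ k, ∑ l ∈ (J k)ᶜ, D k l ^ 2
      + 4 * penalty n n₀ L (rowUnion J).card m / ((n : ℝ) ^ 2 * L))

end

end DSBM

namespace DSBM

/-! The estimator minimises the criterion, so it does at least as well as the true clustering with
coefficients `D*` restricted to a deterministic `J`, whose vector is `θ₀`. Comparing the two leaves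
a cross term between the noise and `θ̂ - θ₀`. This difference lies in the span of `θ₀` and of the
columns of `C Wᵀ` selected by the estimator (`modelSpace`), of dimension at most `|Ĵ| + 1`, so only
the projection of the noise on that space matters (`norm_sq_le_of_penalized`).

The space is random, but it is one of finitely many. For a fixed space of dimension `r`,
independence and boundedness make the noise sub-Gaussian, and the squared norm of its projection has
an exponential moment of at most `2 ^ r` (`measureReal_proj_le`). The penalty is large enough to pay
for these factors and for the number of clusterings and of coefficient sets: the resulting weights
have sum at most 8 (`sum_weights_le`). Hence, outside an event of probability at most `8 e^{-t}`,
the projected noise is absorbed by the penalty of the selected model, up to a multiple of `t`.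

The bias of `θ₀` is the energy of the discarded coefficients: `H` is orthogonal, and by balance each
block repeats a coefficient at most `(α₂ n / m)²` times (`bias_le`). Integrating the tail gives the
bound in expectation. -/

/-! ### Sub-Gaussian concentration of the projected noise -/

open Real in
lemma lintegral_exp_linear_gaussian {κ : Type*} [Fintype κ] (y : κ → ℝ) :
    ∫⁻ g, ENNReal.ofReal (exp (√3 * ∑ i, g i * y i)) ∂(Measure.pi fun _ : κ => gaussianReal 0 1)
      = ENNReal.ofReal (exp (3 / 2 * ∑ i, y i ^ 2)) := by
  have h1 : ∀ c : ℝ, ∫ x, exp (c * x) ∂(gaussianReal 0 1) = exp (c ^ 2 / 2) := by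
    intro c
    have := congrFun (mgf_id_gaussianReal (μ := 0) (v := 1)) c
    simpa [mgf] using this
  have h2 : ∀ g : κ → ℝ, exp (√3 * ∑ i, g i * y i) = ∏ i, exp ((√3 * y i) * g i) := by
    intro g
    rw [← exp_sum, Finset.mul_sum]
    congr 1
    exact Finset.sum_congr rfl fun i _ => by ring
  have h3 : ∫ g, exp (√3 * ∑ i, g i * y i) ∂(Measure.pi fun _ : κ => gaussianReal 0 1)
      = exp (3 / 2 * ∑ i, y i ^ 2) := by
    simp_rw [h2]
    rw [integral_fintype_prod_eq_prod (fun i x => exp ((√3 * y i) * x))]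
    simp_rw [h1]
    rw [← exp_sum, Finset.mul_sum]
    congr 1
    refine Finset.sum_congr rfl fun i _ => ?_
    rw [mul_pow, sq_sqrt (by norm_num)]; ring
  rw [← h3, ofReal_integral_eq_lintegral_ofReal]
  -- A non-integrable function has integral 0, which contradicts the positive value just computed.
  · by_contra h
    rw [integral_undef h] at h3
    exact (exp_pos _).ne h3
  · exact Filter.Eventually.of_forall fun _ => (exp_pos _).le

-- For one coordinate, `E exp(s g²) = (1 - 2s)^{-1/2}`; the exponent `s = 3/8` makes this exactly 2,
-- so each dimension costs a factor 2.
open Real in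
lemma lintegral_exp_sq_gaussian (κ : Type*) [Fintype κ] :
    ∫⁻ g, ENNReal.ofReal (exp (3 / 8 * ∑ i, g i ^ 2)) ∂(Measure.pi fun _ : κ => gaussianReal 0 1)
      = ENNReal.ofReal (2 ^ Fintype.card κ) := by
  have h1 : ∫ x, exp (3 / 8 * x ^ 2) ∂(gaussianReal 0 1) = 2 := by
    rw [integral_gaussianReal_eq_integral_smul one_ne_zero]
    have : ∀ x : ℝ, gaussianPDFReal 0 1 x • exp (3 / 8 * x ^ 2)
        = (√(2 * π))⁻¹ * exp (-(1 / 8) * x ^ 2) := by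
      intro x
      simp only [gaussianPDFReal, NNReal.coe_one, mul_one, sub_zero, smul_eq_mul]
      rw [mul_assoc, ← exp_add]
      congr 2
      ring
    simp_rw [this]
    rw [integral_const_mul, integral_gaussian]
    have : π / (1 / 8) = 2 ^ 2 * (2 * π) := by ring
    rw [this, sqrt_mul (x := 2 ^ 2) (by norm_num), sqrt_sq (x := 2) (by norm_num)]
    have : √(2 * π) ≠ 0 := by positivity
    field_simp
  have h3 : ∫ g, exp (3 / 8 * ∑ i, g i ^ 2) ∂(Measure.pi fun _ : κ => gaussianReal 0 1)
      = 2 ^ Fintype.card κ := by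
    simp_rw [Finset.mul_sum, exp_sum]
    rw [integral_fintype_prod_eq_prod (fun _ x => exp (3 / 8 * x ^ 2))]
    simp [h1]
  rw [← h3, ofReal_integral_eq_lintegral_ofReal]
  · by_contra h
    rw [integral_undef h] at h3
    exact (by positivity : (0 : ℝ) < 2 ^ Fintype.card κ).ne h3
  · exact Filter.Eventually.of_forall fun _ => (exp_pos _).le

open Real in
/-- Exponential moment of the squared norm of a sub-Gaussian vector with variance proxy `1 / 4`. -/
lemma lintegral_exp_sum_sq_le {Ω κ : Type*} [MeasurableSpace Ω] [Fintype κ] (P : Measure Ω)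
    [SFinite P] (Y : κ → Ω → ℝ) (hY : ∀ i, Measurable (Y i))
    (hsub : ∀ g : κ → ℝ, ∫⁻ ω, ENNReal.ofReal (exp (∑ i, g i * Y i ω)) ∂P
      ≤ ENNReal.ofReal (exp ((∑ i, g i ^ 2) / 8))) :
    ∫⁻ ω, ENNReal.ofReal (exp (3 / 2 * ∑ i, Y i ω ^ 2)) ∂P
      ≤ ENNReal.ofReal (2 ^ Fintype.card κ) := by
  -- The quadratic exponent becomes linear in `Y` by averaging over an independent Gaussian vector.
  -- After Tonelli, the sub-Gaussian bound applies for each fixed `g`.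
  simp_rw [← lintegral_exp_linear_gaussian]
  rw [lintegral_lintegral_swap]
  · rw [← lintegral_exp_sq_gaussian κ]
    refine lintegral_mono fun g => ?_
    have := hsub fun i => √3 * g i
    simp only [mul_pow, sq_sqrt (show (0 : ℝ) ≤ 3 by norm_num), ← Finset.mul_sum, mul_assoc] at this
    refine this.trans (le_of_eq ?_)
    congr 2
    ring
  · refine Measurable.aemeasurable ?_
    simp only [Function.uncurry_def]
    fun_prop

/-- Bounded independent centred variables have sub-Gaussian linear combinations. -/
lemma lintegral_exp_linear_le {Ω ι : Type*} [MeasurableSpace Ω] [Fintype ι] (P : Measure Ω)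
    [IsProbabilityMeasure P] (X : ι → Ω → ℝ) (hm : ∀ i, Measurable (X i))
    (h01 : ∀ i ω, X i ω ∈ Set.Icc (0 : ℝ) 1) (hind : iIndepFun X P) (u : ι → ℝ) :
    ∫⁻ ω, ENNReal.ofReal (Real.exp (∑ i, u i * (X i ω - P[X i]))) ∂P
      ≤ ENNReal.ofReal (Real.exp ((∑ i, u i ^ 2) / 8)) := by
  have h1 : ∀ i, HasSubgaussianMGF (fun ω => u i * (X i ω - P[X i]))
      (Real.toNNReal (u i ^ 2) * ((‖(1 : ℝ) - 0‖₊ / 2) ^ 2)) P := fun i => by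
    have := (hasSubgaussianMGF_of_mem_Icc (μ := P) (hm i).aemeasurable
      (Filter.Eventually.of_forall (h01 i))).const_mul (u i)
    rwa [Real.toNNReal_of_nonneg (sq_nonneg _)]
  have h2 : iIndepFun (fun i ω => u i * (X i ω - P[X i])) P :=
    hind.comp (fun i x => u i * (x - ∫ ω, X i ω ∂P)) (fun i => by fun_prop)
  have h3 := HasSubgaussianMGF.sum_of_iIndepFun h2 (s := Finset.univ) (fun i _ => h1 i)
  have h4 := h3.integrable_exp_mul 1
  have h5 := h3.mgf_le 1
  simp only [one_mul, mgf] at h4 h5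
  rw [← ofReal_integral_eq_lintegral_ofReal h4
    (Filter.Eventually.of_forall fun _ => (Real.exp_pos _).le)]
  refine ENNReal.ofReal_le_ofReal (h5.trans (Real.exp_le_exp.2 (le_of_eq ?_)))
  push_cast
  simp only [Real.coe_toNNReal _ (sq_nonneg _), ← Finset.sum_mul]
  norm_num
  ring

/-- The tail bound for the projection of the centred vector on a subspace. -/
lemma measureReal_proj_le {Ω ι : Type*} [MeasurableSpace Ω] [Fintype ι] (P : Measure Ω)
    [IsProbabilityMeasure P] (X : ι → Ω → ℝ) (hm : ∀ i, Measurable (X i))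
    (h01 : ∀ i ω, X i ω ∈ Set.Icc (0 : ℝ) 1) (hind : iIndepFun X P) (μ : ι → ℝ)
    (hμ : ∀ i, P[X i] = μ i) (V : Submodule ℝ (EuclideanSpace ℝ ι)) (r : ℕ)
    (hr : Module.finrank ℝ V ≤ r) (T : ℝ) :
    P.real {ω | T < 8 * ‖V.starProjection (WithLp.toLp 2 fun i => X i ω - μ i)‖ ^ 2}
      ≤ 2 ^ r * Real.exp (-(3 / 16 * T)) := by
  obtain rfl : (fun i => P[X i]) = μ := funext hμ
  set b := stdOrthonormalBasis ℝ V
  let Y : Fin (Module.finrank ℝ V) → Ω → ℝ := fun k ω =>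
    ∑ i, (b k : EuclideanSpace ℝ ι) i * (X i ω - P[X i])
  have hY : ∀ k, Measurable (Y k) := fun k => by simp only [Y]; fun_prop
  have hnorm : ∀ ω, ‖V.starProjection (WithLp.toLp 2 fun i => X i ω - P[X i])‖ ^ 2
      = ∑ k, Y k ω ^ 2 := by
    intro ω
    rw [Submodule.starProjection_apply, ← Submodule.coe_norm, ← b.sum_sq_norm_inner_right]
    refine Finset.sum_congr rfl fun k _ => ?_
    rw [Submodule.inner_orthogonalProjectionOnto_eq_of_mem_left, Real.norm_eq_abs, sq_abs]
    simp [Y, PiLp.inner_apply, mul_comm]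
  have key : ∫⁻ ω, ENNReal.ofReal (Real.exp (3 / 2 * ∑ k, Y k ω ^ 2)) ∂P
      ≤ ENNReal.ofReal (2 ^ r) := by
    refine (lintegral_exp_sum_sq_le P Y hY fun g => ?_).trans (ENNReal.ofReal_le_ofReal ?_)
    -- A combination of the coordinates `Y k` is a combination of the original variables, with a
    -- coefficient vector of the same norm as `g`, by orthonormality.
    · have h1 : ∀ ω, ∑ k, g k * Y k ω
          = ∑ i, (∑ k, g k • (b k : EuclideanSpace ℝ ι)) i * (X i ω - P[X i]) := by
        intro ω
        simp only [Y, Finset.mul_sum, WithLp.ofLp_sum, Finset.sum_apply, Finset.sum_mul]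
        rw [Finset.sum_comm]
        simp [mul_assoc]
      have h2 : ∑ i, (∑ k, g k • (b k : EuclideanSpace ℝ ι)) i ^ 2 = ∑ k, g k ^ 2 := by
        have h3 : ∑ k, g k • (b k : EuclideanSpace ℝ ι) = ((b.repr.symm (WithLp.toLp 2 g) : V) :
            EuclideanSpace ℝ ι) := by
          rw [← b.sum_repr_symm]
          simp
        rw [h3, ← EuclideanSpace.real_norm_sq_eq, ← Submodule.coe_norm, LinearIsometryEquiv.norm_map,
          EuclideanSpace.real_norm_sq_eq]
      simp_rw [h1, ← h2]
      exact lintegral_exp_linear_le P X hm h01 hind _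
    · simpa using pow_le_pow_right₀ (one_le_two (α := ℝ)) hr
  have hsub : {ω | T < 8 * ‖V.starProjection (WithLp.toLp 2 fun i => X i ω - P[X i])‖ ^ 2}
      ⊆ {ω | ENNReal.ofReal (Real.exp (3 / 16 * T))
        ≤ ENNReal.ofReal (Real.exp (3 / 2 * ∑ k, Y k ω ^ 2))} := by
    intro ω hω
    simp only [Set.mem_ofPred_eq, hnorm] at hω ⊢
    exact ENNReal.ofReal_le_ofReal (Real.exp_le_exp.2 (by linarith))
  -- Markov's inequality for the exponential moment; the rate is `3/16 = (3/2)/8`.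
  refine ENNReal.toReal_le_of_le_ofReal (by positivity) ((measure_mono hsub).trans
    ((meas_ge_le_lintegral_div (by fun_prop) (by simp [Real.exp_pos]) (by simp)).trans ?_))
  rw [Real.exp_neg, ← div_eq_mul_inv, ENNReal.ofReal_div_of_pos (Real.exp_pos _)]
  gcongr

/-! ### Counting the models -/

/-- Follows from `n.choose k ≤ n^k / k!` and `k^k / k! ≤ e^k`, the latter being one term of the
exponential series. -/
lemma choose_le_exp_mul_div_pow (n k : ℕ) :
    (n.choose k : ℝ) ≤ (Real.exp 1 * n / k) ^ k := by
  rcases Nat.eq_zero_or_pos k with rfl | hk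
  · simp
  have hk' : (0 : ℝ) < k := by exact_mod_cast hk
  have h1 : (n.choose k : ℝ) ≤ (n : ℝ) ^ k / k.factorial := Nat.choose_le_pow_div k n
  have h2 := Real.pow_div_factorial_le_exp (k : ℝ) hk'.le k
  have h3 : Real.exp k = Real.exp 1 ^ k := by rw [← Real.exp_nat_mul, mul_one]
  rw [h3] at h2
  calc (n.choose k : ℝ) ≤ (n : ℝ) ^ k / k.factorial := h1
    _ = (n : ℝ) ^ k / (k : ℝ) ^ k * ((k : ℝ) ^ k / k.factorial) := by field_simp
    _ ≤ (n : ℝ) ^ k / (k : ℝ) ^ k * Real.exp 1 ^ k := by gcongr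
    _ = _ := by rw [div_pow, mul_pow]; ring

/-- The number of maps that differ from a given one in at most `n₀` points. -/
lemma card_hamming_ball_le {m n n₀ : ℕ} (hn₀ : n₀ ≤ n) (v : Fin n → Fin m) :
    (Finset.univ.filter fun w : Fin n → Fin m =>
      (Finset.univ.filter fun i => v i ≠ w i).card ≤ n₀).card ≤ n.choose n₀ * m ^ n₀ := by
  classical
  have hsub : (Finset.univ.filter fun w : Fin n → Fin m =>
      (Finset.univ.filter fun i => v i ≠ w i).card ≤ n₀)
      ⊆ (Finset.powersetCard n₀ (Finset.univ : Finset (Fin n))).biUnion fun S =>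
        Fintype.piFinset fun i => if i ∈ S then Finset.univ else {v i} := by
    intro w hw
    simp only [Finset.mem_filter, Finset.mem_univ, true_and] at hw
    -- Enlarging the set of differences to exactly `n₀` points, possible as `n₀ ≤ n`, avoids a sum
    -- over smaller cardinalities.
    obtain ⟨S, hS, -, hc⟩ := Finset.exists_subsuperset_card_eq
      (Finset.subset_univ (Finset.univ.filter fun i => v i ≠ w i)) hw (by simpa using hn₀)
    simp only [Finset.mem_biUnion, Finset.mem_powersetCard, Fintype.mem_piFinset]
    refine ⟨S, ⟨Finset.subset_univ _, hc⟩, fun i => ?_⟩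
    split_ifs with h
    · simp
    · have : ¬ v i ≠ w i := fun h' => h (hS (by simp [h']))
      simpa using (not_not.1 this).symm
  refine (Finset.card_le_card hsub).trans (Finset.card_biUnion_le.trans (le_of_eq ?_))
  rw [Finset.sum_congr rfl (g := fun _ => m ^ n₀)]
  · simp
  · intro S hS
    rw [Finset.mem_powersetCard] at hS
    rw [Fintype.card_piFinset]
    have : ∀ i, (if i ∈ S then Finset.univ else {v i} : Finset (Fin m)).card
        = if i ∈ S then m else 1 := fun i => by split_ifs <;> simp
    simp_rw [this]
    rw [Finset.prod_ite_mem, Finset.univ_inter, Finset.prod_const, hS.2]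

-- The first time instant is free, with `m ^ n` choices, and each later one lies in a Hamming ball
-- around its predecessor. The induction removes the last instant.
open Classical in
lemma card_clusterings_le {m n n₀ : ℕ} (hn₀ : n₀ ≤ n) (L : ℕ) :
    (Finset.univ.filter fun z : Clustering m n (L + 1) => z ∈ clusterings m n n₀ (L + 1)).card
      ≤ m ^ n * (n.choose n₀ * m ^ n₀) ^ L := by
  induction L with
  | zero =>
    refine (Finset.card_filter_le _ _).trans ?_
    simp
  | succ L ih =>
    rw [pow_succ, ← mul_assoc]
    refine le_trans ?_ (Nat.mul_le_mul_right _ ih)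
    rw [mul_comm]
    refine Finset.card_le_mul_card_image_of_maps_to (f := fun z : Clustering m n (L + 2) =>
      (Fin.init z : Clustering m n (L + 1))) ?_ _ ?_
    · intro z hz
      simp only [Finset.mem_filter, Finset.mem_univ, true_and] at hz ⊢
      intro l l' hl
      exact hz l.castSucc l'.castSucc (by simpa using hl)
    · intro z' _
      refine le_trans ?_ (card_hamming_ball_le hn₀ (z' (Fin.last L)))
      refine Finset.card_le_card_of_injOn (fun z => z (Fin.last (L + 1))) ?_ ?_
      · intro z hz
        simp only [Finset.coe_filter, Finset.mem_filter, Finset.mem_univ, true_and] at hz ⊢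
        obtain ⟨hz, rfl⟩ := hz
        exact hz (Fin.last L).castSucc (Fin.last (L + 1)) (by simp)
      · intro z hz w hw h
        simp only [Finset.coe_filter, Finset.mem_filter, Finset.mem_univ, true_and] at hz hw
        have h' : (Fin.init z : Clustering m n (L + 1)) = Fin.init w := hz.2.trans hw.2.symm
        rw [← Fin.snoc_init_self z, ← Fin.snoc_init_self w]
        exact congrArg₂ _ h' h

lemma one_le_div_of_mem {m n n₀ : ℕ} (hm : 1 ≤ m) (h0 : 1 ≤ n₀) (hn₀ : n₀ ≤ n) :
    1 ≤ (m : ℝ) * n * Real.exp 1 / n₀ := by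
  have h0' : (0 : ℝ) < n₀ := by exact_mod_cast h0
  have hm' : (1 : ℝ) ≤ m := by exact_mod_cast hm
  have hn' : (n₀ : ℝ) ≤ n := by exact_mod_cast hn₀
  have he := Real.one_le_exp (zero_le_one (α := ℝ))
  rw [le_div_iff₀ h0', one_mul]
  calc (n₀ : ℝ) ≤ 1 * n * 1 := by linarith
    _ ≤ _ := by gcongr

lemma switch_term_nonneg {m n n₀ L : ℕ} (hm : 1 ≤ m) (hL : 1 ≤ L) (hn₀ : n₀ ≤ n) :
    0 ≤ (n₀ : ℝ) * ((L : ℝ) - 1) * Real.log ((m : ℝ) * n * Real.exp 1 / n₀) := by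
  rcases Nat.eq_zero_or_pos n₀ with rfl | h0
  · simp
  · have := Real.log_nonneg (one_le_div_of_mem hm h0 hn₀)
    have hL' : (1 : ℝ) ≤ L := by exact_mod_cast hL
    exact mul_nonneg (mul_nonneg (by positivity) (by linarith)) this

open Classical in
/-- The logarithm of the number of clusterings is at most the respective part of the penalty. -/
lemma card_clusterings_le_exp {m n n₀ L : ℕ} (hm : 1 ≤ m) (hL : 1 ≤ L) (hn₀ : n₀ ≤ n) :
    ((Finset.univ.filter fun z : Clustering m n L => z ∈ clusterings m n n₀ L).card : ℝ)
      ≤ Real.exp (n * Real.log m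
        + n₀ * ((L : ℝ) - 1) * Real.log ((m : ℝ) * n * Real.exp 1 / n₀)) := by
  obtain ⟨L, rfl⟩ := Nat.exists_eq_add_of_le' hL
  have hm' : (0 : ℝ) < m := by exact_mod_cast hm
  have h1 : ((Finset.univ.filter fun z : Clustering m n (L + 1) =>
      z ∈ clusterings m n n₀ (L + 1)).card : ℝ)
      ≤ (m : ℝ) ^ n * ((n.choose n₀ : ℝ) * (m : ℝ) ^ n₀) ^ L := by
    exact_mod_cast card_clusterings_le (m := m) hn₀ L
  have h2 : (n.choose n₀ : ℝ) * (m : ℝ) ^ n₀ ≤ ((m : ℝ) * n * Real.exp 1 / n₀) ^ n₀ := by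
    calc (n.choose n₀ : ℝ) * (m : ℝ) ^ n₀ ≤ (Real.exp 1 * n / n₀) ^ n₀ * (m : ℝ) ^ n₀ := by
          gcongr
          exact choose_le_exp_mul_div_pow n n₀
      _ = _ := by rw [← mul_pow]; ring
  have h3 : ((m : ℝ) * n * Real.exp 1 / n₀) ^ n₀
      = Real.exp (n₀ * Real.log ((m : ℝ) * n * Real.exp 1 / n₀)) := by
    rcases Nat.eq_zero_or_pos n₀ with rfl | h0
    · simp
    · rw [Real.exp_nat_mul, Real.exp_log (by linarith [one_le_div_of_mem hm h0 hn₀])]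
  rw [Real.exp_add, Real.exp_nat_mul, Real.exp_log hm']
  refine h1.trans ?_
  gcongr
  calc ((n.choose n₀ : ℝ) * (m : ℝ) ^ n₀) ^ L
      ≤ (((m : ℝ) * n * Real.exp 1 / n₀) ^ n₀) ^ L := by gcongr
    _ = _ := by
      rw [h3, ← Real.exp_nat_mul]
      push_cast
      congr 1
      ring

lemma card_classPair_le (m : ℕ) : Fintype.card (ClassPair m) ≤ m ^ 2 := by
  have := Fintype.card_le_of_surjective (fun p : Fin m × Fin m => s(p.1, p.2))
    (fun k => by induction k using Sym2.ind with | _ a b => exact ⟨(a, b), rfl⟩)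
  simpa [sq] using this

lemma card_coeff_le (m L : ℕ) : Fintype.card (Fin L × ClassPair m) ≤ m ^ 2 * L := by
  rw [Fintype.card_prod, Fintype.card_fin, mul_comm]
  exact Nat.mul_le_mul_right _ (card_classPair_le m)

lemma one_le_ratio {m L j : ℕ} (hj : 1 ≤ j) (hjN : j ≤ m ^ 2 * L) :
    1 ≤ (m : ℝ) ^ 2 * L / j := by
  rw [le_div_iff₀ (by exact_mod_cast hj), one_mul]
  exact_mod_cast hjN

lemma coeff_term_nonneg {m L j : ℕ} (hjN : j ≤ m ^ 2 * L) :
    0 ≤ (j : ℝ) / 2 * Real.log (25 * (m : ℝ) ^ 2 * L / j) := by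
  rcases Nat.eq_zero_or_pos j with rfl | h0
  · simp
  · refine mul_nonneg (by positivity) (Real.log_nonneg ?_)
    have := one_le_ratio h0 hjN
    rw [mul_assoc, mul_div_assoc]
    linarith

/-- With `x = m² L / j ≥ 1`, the number of sets is at most `(e x)^j`, while the penalty contributes
at most `(25 x)^{-2j}`. What remains is geometric in `j`. -/
lemma choose_mul_exp_le {m L N j : ℕ} (hN : N ≤ m ^ 2 * L) (hj : j ≤ N) :
    (N.choose j : ℝ) * (2 ^ (j + 1)
      * Real.exp (-(33 / 8 * ((j : ℝ) / 2 * Real.log (25 * (m : ℝ) ^ 2 * L / j)))))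
      ≤ 2 * (1 / 2) ^ j := by
  rcases Nat.eq_zero_or_pos j with rfl | h0
  · simp
  have hx := one_le_ratio h0 (hj.trans hN)
  have hj0 : (0 : ℝ) < j := by exact_mod_cast h0
  have hnn := coeff_term_nonneg (hj.trans hN)
  set x := (m : ℝ) ^ 2 * L / j with hxdef
  have hx25 : 25 * (m : ℝ) ^ 2 * L / j = 25 * x := by rw [hxdef]; ring
  rw [hx25] at hnn ⊢
  have h1 : (N.choose j : ℝ) ≤ (Real.exp 1 * x) ^ j := by
    refine (choose_le_exp_mul_div_pow N j).trans ?_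
    rw [hxdef, mul_div_assoc]
    gcongr
    exact_mod_cast hN
  -- Weakening `33/8` to 4 gives an integer power.
  have h2 : Real.exp (-(33 / 8 * ((j : ℝ) / 2 * Real.log (25 * x)))) ≤ (((25 * x) ^ 2)⁻¹) ^ j := by
    have : (((25 * x) ^ 2)⁻¹) ^ j = Real.exp (-(4 * (j / 2 * Real.log (25 * x)))) := by
      rw [← Real.exp_log (show 0 < (((25 * x) ^ 2)⁻¹) ^ j by positivity), Real.log_pow,
        Real.log_inv, Real.log_pow]
      congr 1
      push_cast
      ring
    rw [this]
    exact Real.exp_le_exp.2 (by linarith)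
  have he := Real.exp_one_lt_d9
  calc _ ≤ (Real.exp 1 * x) ^ j * (2 ^ (j + 1) * (((25 * x) ^ 2)⁻¹) ^ j) := by gcongr
    _ = 2 * ((Real.exp 1 * x) * 2 * ((25 * x) ^ 2)⁻¹) ^ j := by
      generalize ((25 * x) ^ 2)⁻¹ = y
      ring
    _ ≤ 2 * (1 / 2) ^ j := by
      gcongr
      -- The ratio is `2e / (625 x)`, well below `1/2`.
      rw [← div_eq_mul_inv, div_le_iff₀ (by positivity)]
      nlinarith

lemma sum_coeff_sets_le (m L : ℕ) :
    ∑ J : Finset (Fin L × ClassPair m), (2 : ℝ) ^ (J.card + 1)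
      * Real.exp (-(33 / 8 * ((J.card : ℝ) / 2 * Real.log (25 * (m : ℝ) ^ 2 * L / J.card))))
      ≤ 4 := by
  rw [← Finset.powerset_univ, Finset.sum_powerset_apply_card (fun j : ℕ => (2 : ℝ) ^ (j + 1)
      * Real.exp (-(33 / 8 * ((j : ℝ) / 2 * Real.log (25 * (m : ℝ) ^ 2 * L / j)))))]
  calc _ ≤ ∑ j ∈ Finset.range ((Finset.univ : Finset (Fin L × ClassPair m)).card + 1),
        2 * (1 / 2 : ℝ) ^ j := by
        refine Finset.sum_le_sum fun j hj => ?_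
        rw [nsmul_eq_mul]
        exact choose_mul_exp_le (card_coeff_le m L) (by simpa [Nat.lt_succ_iff] using hj)
    _ ≤ 4 := by
        rw [← Finset.mul_sum]
        have := Summable.sum_le_tsum
          (Finset.range ((Finset.univ : Finset (Fin L × ClassPair m)).card + 1))
          (fun j _ => by positivity) summable_geometric_two
        rw [tsum_geometric_two] at this
        linarith

lemma sum_inv_sq_le_two (n : ℕ) : ∑ m ∈ Finset.Icc 1 n, ((m : ℝ) ^ 2)⁻¹ ≤ 2 := by
  have := sum_Ioo_inv_sq_le (α := ℝ) 0 (n + 1)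
  have h : Finset.Ioo 0 (n + 1) = Finset.Icc 1 n := by ext; simp; omega
  rw [h] at this
  simpa using this

open Classical in
/-- The exponential weights of all models sum to at most `8`. -/
lemma sum_weights_le {n n₀ L : ℕ} (hn : 1 ≤ n) (hL : 1 ≤ L) (hn₀ : n₀ ≤ n) :
    ∑ m ∈ Finset.Icc 1 n, ∑ _z ∈ Finset.univ.filter fun z : Clustering m n L =>
      z ∈ clusterings m n n₀ L, ∑ J : Finset (Fin L × ClassPair m),
        (2 : ℝ) ^ (J.card + 1) * Real.exp (-(3 / 8 * penalty n n₀ L J.card m)) ≤ 8 := by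
  have key : ∀ m ∈ Finset.Icc 1 n, ∑ _z ∈ Finset.univ.filter fun z : Clustering m n L =>
      z ∈ clusterings m n n₀ L, ∑ J : Finset (Fin L × ClassPair m),
        (2 : ℝ) ^ (J.card + 1) * Real.exp (-(3 / 8 * penalty n n₀ L J.card m))
      ≤ 4 * ((m : ℝ) ^ 2)⁻¹ := by
    intro m hm
    have hm1 : 1 ≤ m := (Finset.mem_Icc.1 hm).1
    have hm' : (1 : ℝ) ≤ m := by exact_mod_cast hm1
    have hcard := card_clusterings_le_exp (n := n) hm1 hL hn₀
    have hB := switch_term_nonneg (n := n) hm1 hL hn₀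
    have hA : 0 ≤ (n : ℝ) * Real.log m := mul_nonneg (by positivity) (Real.log_nonneg hm')
    -- The surplus in the term `n log m` makes the sum over `m` converge.
    have hA2 : Real.exp (-(2 * (n * Real.log m))) ≤ ((m : ℝ) ^ 2)⁻¹ := by
      rw [← Real.exp_log (show 0 < ((m : ℝ) ^ 2)⁻¹ by positivity), Real.log_inv, Real.log_pow]
      refine Real.exp_le_exp.2 ?_
      have h1 : (1 : ℝ) ≤ n := by exact_mod_cast hn
      have := Real.log_nonneg hm'
      push_cast
      nlinarith
    set A := (n : ℝ) * Real.log m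
    set B := (n₀ : ℝ) * ((L : ℝ) - 1) * Real.log ((m : ℝ) * n * Real.exp 1 / n₀)
    -- `33/8 = 11 · 3/8`, with 11 the constant of the penalty. One unit of `A + B` will pay for the
    -- number of clusterings, which leaves `25/8`.
    have hsum : ∑ J : Finset (Fin L × ClassPair m),
        (2 : ℝ) ^ (J.card + 1) * Real.exp (-(3 / 8 * penalty n n₀ L J.card m))
        ≤ Real.exp (-(33 / 8 * (A + B))) * 4 := by
      refine le_trans (le_of_eq ?_)
        (mul_le_mul_of_nonneg_left (sum_coeff_sets_le m L) (Real.exp_pos _).le)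
      rw [Finset.mul_sum]
      refine Finset.sum_congr rfl fun J _ => ?_
      rw [mul_left_comm, ← Real.exp_add]
      congr 2
      simp only [penalty, A, B]
      ring
    rw [Finset.sum_const, nsmul_eq_mul]
    calc _ ≤ Real.exp (A + B) * (Real.exp (-(33 / 8 * (A + B))) * 4) := by
          gcongr
      _ = 4 * Real.exp (-(25 / 8 * (A + B))) := by
          rw [← mul_assoc, ← Real.exp_add, mul_comm]
          congr 2
          ring
      _ ≤ 4 * Real.exp (-(2 * A)) := by
          exact mul_le_mul_of_nonneg_left (Real.exp_le_exp.2 (by linarith)) (by norm_num)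
      _ ≤ _ := by gcongr
  refine (Finset.sum_le_sum key).trans ?_
  rw [← Finset.mul_sum]
  linarith [sum_inv_sq_le_two n]

/-! ### From tails to expectations; integrability -/

/-- A real random variable with exponential tails above `o`. -/
lemma integral_le_of_tail {Ω : Type*} [MeasurableSpace Ω] (P : Measure Ω) [IsProbabilityMeasure P]
    (X : Ω → ℝ) (hX : Integrable X P) (o c K : ℝ) (hc : 0 < c)
    (htail : ∀ t, 0 < t → P.real {ω | o + c * t < X ω} ≤ K * Real.exp (-t)) :
    ∫ ω, X ω ∂P ≤ o + c * K := by
  set Y : Ω → ℝ := fun ω => max (X ω - o) 0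
  have hY : Integrable Y P := (hX.sub (integrable_const o)).pos_part
  have h1 : ∫ ω, X ω ∂P - o ≤ ∫ ω, Y ω ∂P := by
    have : ∫ ω, (X ω - o) ∂P = ∫ ω, X ω ∂P - o := by
      rw [integral_sub hX (integrable_const o)]; simp
    rw [← this]
    exact integral_mono (hX.sub (integrable_const o)) hY fun ω => le_max_left _ _
  have hexp : IntegrableOn (fun t => K * Real.exp (-c⁻¹ * t)) (Set.Ioi 0) :=
    (integrableOn_exp_mul_Ioi (by simpa using hc) 0).const_mul K
  have h2 : ∫ ω, Y ω ∂P ≤ c * K := by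
    rw [hY.integral_eq_integral_meas_lt (Filter.Eventually.of_forall fun _ => le_max_right _ _)]
    calc _ ≤ ∫ t in Set.Ioi (0 : ℝ), K * Real.exp (-c⁻¹ * t) := by
          refine integral_mono_of_nonneg (Filter.Eventually.of_forall fun _ => measureReal_nonneg)
            hexp ?_
          filter_upwards [ae_restrict_mem measurableSet_Ioi] with t ht
          have ht' : (0 : ℝ) < t := ht
          have hset : {ω | t < Y ω} ⊆ {ω | o + c * (c⁻¹ * t) < X ω} := by
            intro ω hω
            simp only [Set.mem_ofPred_eq, Y, lt_max_iff] at hω ⊢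
            rw [mul_inv_cancel_left₀ hc.ne']
            rcases hω with h | h <;> linarith
          refine (measureReal_mono hset).trans ((htail _ (by positivity)).trans (le_of_eq ?_))
          rw [neg_mul]
      _ = c * K := by
          rw [integral_const_mul, integral_exp_mul_Ioi (by simpa using hc)]
          simp [mul_comm]
  linarith

/-- Functions of a measurable map that takes values in a finite set are integrable. -/
lemma integrable_comp_of_finite {Ω T : Type*} [MeasurableSpace Ω] [MeasurableSpace T]
    [MeasurableSingletonClass T] (P : Measure Ω) [IsFiniteMeasure P] (B : Ω → T)
    (hB : Measurable B) (A : Set T) (hA : A.Finite) (hBA : ∀ ω, B ω ∈ A) (F : T → ℝ) :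
    Integrable (fun ω => F (B ω)) P := by
  -- `F` is arbitrary: a preimage under it only matters on the finite range of `B`, where every set
  -- is measurable.
  have hm : Measurable fun ω => F (B ω) := by
    intro s _
    have : (fun ω => F (B ω)) ⁻¹' s = B ⁻¹' (F ⁻¹' s ∩ A) := by
      ext ω; simp [hBA ω]
    rw [this]
    exact hB (hA.subset Set.inter_subset_right).measurableSet
  obtain ⟨C, hC⟩ := (hA.image fun b => ‖F b‖).bddAbove
  exact Integrable.of_bound hm.aestronglyMeasurable C
    (Filter.Eventually.of_forall fun ω => hC ⟨B ω, hBA ω, rfl⟩)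

lemma finite_isAdjacency (n L : ℕ) : {b : Tensor n L | IsAdjacency b}.Finite := by
  refine Set.Finite.subset (Set.Finite.pi' fun _ : Fin n => Set.Finite.pi' fun _ : Fin n =>
    Set.Finite.pi' fun _ : Fin L => (Set.toFinite ({0, 1} : Set ℝ))) ?_
  intro b hb i j l
  simpa using hb.1 i j l

/-! ### Basic inequality and bias -/

/-- The basic inequality for penalized least squares. -/
lemma norm_sq_le_of_penalized {E : Type*} [NormedAddCommGroup E] [InnerProductSpace ℝ E]
    (V : Submodule ℝ E) [V.HasOrthogonalProjection] (a θ θ' θ₀ : E) (p p₀ : ℝ) (hθ' : θ' ∈ V)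
    (hθ₀ : θ₀ ∈ V) (h : ‖a - θ'‖ ^ 2 + p ≤ ‖a - θ₀‖ ^ 2 + p₀) :
    ‖θ' - θ‖ ^ 2 ≤ 3 * ‖θ₀ - θ‖ ^ 2 + 8 * ‖V.starProjection (a - θ)‖ ^ 2 + 2 * p₀ - 2 * p := by
  have e1 : ‖a - θ'‖ ^ 2 = ‖a - θ‖ ^ 2 - 2 * inner ℝ (a - θ) (θ' - θ) + ‖θ' - θ‖ ^ 2 := by
    rw [← norm_sub_sq_real]; congr 2; abel
  have e2 : ‖a - θ₀‖ ^ 2 = ‖a - θ‖ ^ 2 - 2 * inner ℝ (a - θ) (θ₀ - θ) + ‖θ₀ - θ‖ ^ 2 := by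
    rw [← norm_sub_sq_real]; congr 2; abel
  have e3 : inner ℝ (a - θ) (θ' - θ) - inner ℝ (a - θ) (θ₀ - θ)
      = inner ℝ (V.starProjection (a - θ)) (θ' - θ₀) := by
    rw [Submodule.inner_starProjection_left_eq_right,
      Submodule.starProjection_eq_self_iff.2 (V.sub_mem hθ' hθ₀), ← inner_sub_right]
    congr 1; abel
  have e4 := real_inner_le_norm (V.starProjection (a - θ)) (θ' - θ₀)
  have e5 : ‖θ' - θ₀‖ ≤ ‖θ' - θ‖ + ‖θ₀ - θ‖ := by
    rw [norm_sub_rev θ₀ θ]; exact norm_sub_le_norm_sub_add_norm_sub _ _ _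
  have e6 := mul_le_mul_of_nonneg_left e5 (norm_nonneg (V.starProjection (a - θ)))
  -- Young's inequality `2xy ≤ 2x² + y²/2`, used for both distances; half of `‖θ' - θ‖²` moves to
  -- the left and everything is doubled.
  nlinarith [sq_nonneg (2 * ‖V.starProjection (a - θ)‖ - ‖θ' - θ‖),
    sq_nonneg (2 * ‖V.starProjection (a - θ)‖ - ‖θ₀ - θ‖)]

lemma pairMatrix_mulVec {m n L : ℕ} (z : Clustering m n L) (x : Fin L × ClassPair m → ℝ)
    (p : Fin L × NodePair n) :
    (pairMatrix z).mulVec x p = x (p.1, s(z p.1 p.2.1.1, z p.1 p.2.1.2)) := by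
  simp only [Matrix.mulVec, dotProduct, pairMatrix, Matrix.of_apply, ite_mul, one_mul, zero_mul]
  rw [Finset.sum_eq_single (p.1, s(z p.1 p.2.1.1, z p.1 p.2.1.2))]
  · simp
  · rintro ⟨l, k⟩ - h
    rw [if_neg]
    rintro ⟨rfl, rfl⟩
    exact h rfl
  · simp

lemma transformMatrix_transpose_mulVec {m L : ℕ} (H : Matrix (Fin L) (Fin L) ℝ)
    (d : Fin L × ClassPair m → ℝ) (j : Fin L × ClassPair m) :
    (transformMatrix m H).transpose.mulVec d j = ∑ l, H l j.1 * d (l, j.2) := by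
  simp only [Matrix.mulVec, dotProduct, transformMatrix, Matrix.transpose_apply,
    Matrix.kroneckerMap_apply, Fintype.sum_prod_type]
  refine Finset.sum_congr rfl fun l _ => ?_
  rw [Finset.sum_eq_single j.2]
  · simp
  · intro k _ h
    simp [h]
  · simp

/-- The orthogonal transform preserves the sum of squares. -/
lemma sum_sq_transform {m L : ℕ} (H : Matrix (Fin L) (Fin L) ℝ) (hH' : H * H.transpose = 1)
    (d : Fin L × ClassPair m → ℝ) :
    ∑ j, (transformMatrix m H).transpose.mulVec d j ^ 2 = ∑ j, d j ^ 2 := by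
  have h : transformMatrix m H * (transformMatrix m H).transpose = 1 := by
    rw [transformMatrix, ← Matrix.kroneckerMap_transpose, ← Matrix.mul_kronecker_mul, hH']
    simp
  have : (transformMatrix m H).transpose.mulVec d ⬝ᵥ (transformMatrix m H).transpose.mulVec d
      = d ⬝ᵥ d := by
    rw [Matrix.dotProduct_mulVec, Matrix.vecMul_transpose, Matrix.mulVec_mulVec, h,
      Matrix.one_mulVec]
  simpa [dotProduct, sq] using this

/-- The number of node pairs with a given pair of classes. -/
lemma card_block_le {m n L : ℕ} (z : Clustering m n L) (l : Fin L) (a b : Fin m) :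
    (Finset.univ.filter fun p : NodePair n => s(z l p.1.1, z l p.1.2) = s(a, b)).card
      ≤ classSize z l a * classSize z l b := by
  rw [classSize, classSize, ← Finset.card_product]
  -- Each pair is oriented so that its node of class `a` comes first. Orientation loses nothing, as
  -- a pair satisfies `i < j`.
  refine Finset.card_le_card_of_injOn
    (fun p => if z l p.1.1 = a ∧ z l p.1.2 = b then p.1 else (p.1.2, p.1.1)) ?_ ?_
  · intro p hp
    simp only [Finset.coe_filter, Finset.mem_univ, true_and, Set.mem_ofPred_eq, Sym2.eq_iff] at hp
    simp only [Finset.coe_product, Finset.coe_filter, Finset.mem_univ, true_and, Set.mem_prod,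
      Set.mem_ofPred_eq]
    split_ifs with h
    · exact h
    · have := hp.resolve_left h
      exact ⟨this.2, this.1⟩
  · rintro ⟨⟨i, j⟩, hij⟩ - ⟨⟨i', j'⟩, hij'⟩ - h
    simp only at hij hij' h
    split_ifs at h <;> simp only [Prod.mk.injEq] at h <;> obtain ⟨rfl, rfl⟩ := h
    · rfl
    · exact absurd hij (not_lt.2 hij'.le)
    · exact absurd hij (not_lt.2 hij'.le)
    · rfl

lemma sum_sq_pairMatrix_le {m n L : ℕ} {α₁ α₂ : ℝ} (hα₂ : 0 ≤ α₂) (z : Clustering m n L)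
    (hz : IsBalanced α₁ α₂ z) (x : Fin L × ClassPair m → ℝ) :
    ∑ p, (pairMatrix z).mulVec x p ^ 2 ≤ (α₂ * ((n : ℝ) / m)) ^ 2 * ∑ j, x j ^ 2 := by
  simp_rw [pairMatrix_mulVec, Fintype.sum_prod_type, Finset.mul_sum]
  refine Finset.sum_le_sum fun l _ => ?_
  rw [← Finset.sum_fiberwise Finset.univ (fun p : NodePair n => s(z l p.1.1, z l p.1.2))]
  refine Finset.sum_le_sum fun k _ => ?_
  rw [Finset.sum_congr rfl (g := fun _ => x (l, k) ^ 2)]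
  · rw [Finset.sum_const, nsmul_eq_mul]
    refine mul_le_mul_of_nonneg_right ?_ (sq_nonneg _)
    induction k using Sym2.ind with
    | _ a b =>
      calc _ ≤ ((classSize z l a * classSize z l b : ℕ) : ℝ) := by
            exact_mod_cast card_block_le z l a b
        _ ≤ (α₂ * ((n : ℝ) / m)) * (α₂ * ((n : ℝ) / m)) := by
            push_cast
            exact mul_le_mul (hz l a).2 (hz l b).2 (by positivity) (by positivity)
        _ = _ := by ring
  · intro p hp
    rw [(Finset.mem_filter.1 hp).2]

/-- The oracle coefficients restricted to `J`. -/
noncomputable def restrictedCoeff {m L : ℕ} (D : Matrix (ClassPair m) (Fin L) ℝ)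
    (J : ClassPair m → Finset (Fin L)) : Fin L × ClassPair m → ℝ :=
  fun j => if j ∈ rowUnion J then D j.2 j.1 else 0

lemma unpack_probTensor {m n L : ℕ} (z : Clustering m n L) (Q : Matrix (ClassPair m) (Fin L) ℝ)
    (H : Matrix (Fin L) (Fin L) ℝ) (hH : H.transpose * H = 1) :
    unpack (probTensor z Q) = (pairMatrix z * (transformMatrix m H).transpose).mulVec
      fun j => (Q * H.transpose) j.2 j.1 := by
  ext ⟨l, p⟩
  have hQ : Q * H.transpose * H = Q := by rw [Matrix.mul_assoc, hH, Matrix.mul_one]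
  rw [← Matrix.mulVec_mulVec, pairMatrix_mulVec, transformMatrix_transpose_mulVec]
  simp only [unpack, probTensor, if_neg p.2.ne]
  conv_lhs => rw [← hQ]
  rw [Matrix.mul_apply]
  exact Finset.sum_congr rfl fun _ _ => mul_comm _ _

lemma bias_le {m n L : ℕ} {α₁ α₂ : ℝ} (hα₂ : 0 ≤ α₂) (z : Clustering m n L)
    (hz : IsBalanced α₁ α₂ z) (Q : Matrix (ClassPair m) (Fin L) ℝ)
    (H : Matrix (Fin L) (Fin L) ℝ) (hH : H.transpose * H = 1) (hH' : H * H.transpose = 1)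
    (J : ClassPair m → Finset (Fin L)) :
    ∑ p, ((pairMatrix z * (transformMatrix m H).transpose).mulVec
        (restrictedCoeff (Q * H.transpose) J) p - unpack (probTensor z Q) p) ^ 2
      ≤ (α₂ * ((n : ℝ) / m)) ^ 2 * ∑ k, ∑ l ∈ (J k)ᶜ, (Q * H.transpose) k l ^ 2 := by
  rw [unpack_probTensor z Q H hH]
  set D := Q * H.transpose
  simp_rw [← Pi.sub_apply, ← Matrix.mulVec_sub, ← Matrix.mulVec_mulVec]
  refine (sum_sq_pairMatrix_le hα₂ z hz _).trans (le_of_eq ?_)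
  rw [sum_sq_transform H hH', Fintype.sum_prod_type_right]
  congr 1
  refine Finset.sum_congr rfl fun k _ => ?_
  rw [← Finset.sum_filter_add_sum_filter_not Finset.univ (fun l => l ∈ J k),
    Finset.sum_eq_zero, zero_add]
  · refine Finset.sum_congr (by ext; simp) fun l hl => ?_
    have : l ∉ J k := by simpa using hl
    simp [restrictedCoeff, rowUnion, this]
  · intro l hl
    have : l ∈ J k := by simpa using hl
    simp [restrictedCoeff, rowUnion, this]

/-- Both tensors are symmetric with zero diagonal. The factor 2 turns the constants 3, 2 and 19 of
the vector bound into 6, 4 and 38. -/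
lemma normSq_pack_sub {m n L : ℕ} (z : Clustering m n L) (Q : Matrix (ClassPair m) (Fin L) ℝ)
    (θ : Fin L × NodePair n → ℝ) :
    normSq (fun i j l => pack θ i j l - probTensor z Q i j l)
      = 2 * ∑ p, (θ p - unpack (probTensor z Q) p) ^ 2 := by
  set f : Fin n → Fin n → ℝ := fun i j => ∑ l, (pack θ i j l - probTensor z Q i j l) ^ 2 with hf
  have hsymm : ∀ i j, f i j = f j i := by
    intro i j
    refine Finset.sum_congr rfl fun l _ => ?_
    have h1 : probTensor z Q i j l = probTensor z Q j i l := by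
      simp only [probTensor, eq_comm (a := i), Sym2.eq_swap]
    have h2 : pack θ i j l = pack θ j i l := by
      rcases lt_trichotomy i j with h | h | h
      · simp [pack, h, h.not_gt]
      · rw [h]
      · simp [pack, h, h.not_gt]
    rw [h1, h2]
  have hdiag : ∀ i, f i i = 0 := fun i => by simp [hf, pack, probTensor]
  have hlt : ∑ q : Fin n × Fin n with q.1 < q.2, f q.1 q.2
      = ∑ p, (θ p - unpack (probTensor z Q) p) ^ 2 := by
    rw [Fintype.sum_prod_type_right, Finset.sum_subtype (p := fun q : Fin n × Fin n => q.1 < q.2)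
      _ (by simp)]
    refine Finset.sum_congr rfl fun p _ => Finset.sum_congr rfl fun l _ => ?_
    simp [pack, unpack, p.2]
  have hgt : ∑ q : Fin n × Fin n with q.2 < q.1, f q.1 q.2
      = ∑ q : Fin n × Fin n with q.1 < q.2, f q.1 q.2 := by
    refine Finset.sum_nbij' Prod.swap Prod.swap ?_ ?_ ?_ ?_ ?_
    · simp
    · simp
    · simp
    · simp
    · intro q _
      exact hsymm _ _
  have htot : normSq (fun i j l => pack θ i j l - probTensor z Q i j l)
      = ∑ q : Fin n × Fin n, f q.1 q.2 := by
    rw [Fintype.sum_prod_type]; rfl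
  rw [htot, ← Finset.sum_filter_add_sum_filter_not Finset.univ
    (fun q : Fin n × Fin n => q.1 < q.2), hlt]
  have : ∑ q : Fin n × Fin n with ¬ q.1 < q.2, f q.1 q.2
      = ∑ q : Fin n × Fin n with q.2 < q.1, f q.1 q.2 := by
    symm
    refine Finset.sum_subset ?_ ?_
    · intro q
      simpa using fun h => le_of_lt h
    · intro q hq hq'
      simp only [Finset.mem_filter, Finset.mem_univ, true_and, not_lt] at hq hq'
      rw [le_antisymm hq hq']
      exact hdiag _
  rw [this, hgt, hlt]
  ring

/-! ### Model spaces and admissibility of the truth -/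

/-- The span of the columns of `C Wᵀ` with indices in `J` and of a fixed vector. -/
noncomputable def modelSpace {m n L : ℕ} (H : Matrix (Fin L) (Fin L) ℝ)
    (θ₀ : Fin L × NodePair n → ℝ) (z : Clustering m n L) (J : Finset (Fin L × ClassPair m)) :
    Submodule ℝ (EuclideanSpace ℝ (Fin L × NodePair n)) :=
  Submodule.span ℝ (insert (WithLp.toLp 2 θ₀) ((fun j => WithLp.toLp 2
    ((pairMatrix z * (transformMatrix m H).transpose).col j)) '' (J : Set (Fin L × ClassPair m))))

lemma finrank_modelSpace_le {m n L : ℕ} (H : Matrix (Fin L) (Fin L) ℝ)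
    (θ₀ : Fin L × NodePair n → ℝ) (z : Clustering m n L) (J : Finset (Fin L × ClassPair m)) :
    Module.finrank ℝ (modelSpace H θ₀ z J) ≤ J.card + 1 := by
  classical
  have := finrank_span_finset_le_card (R := ℝ) (insert (WithLp.toLp 2 θ₀) (J.image fun j =>
    WithLp.toLp 2 ((pairMatrix z * (transformMatrix m H).transpose).col j)))
  rw [Finset.coe_insert, Finset.coe_image] at this
  exact this.trans ((Finset.card_insert_le _ _).trans (by gcongr; exact Finset.card_image_le))

lemma mulVec_mem_modelSpace {m n L : ℕ} (H : Matrix (Fin L) (Fin L) ℝ)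
    (θ₀ : Fin L × NodePair n → ℝ) (z : Clustering m n L) (J : Finset (Fin L × ClassPair m))
    (d : Fin L × ClassPair m → ℝ) (hd : ∀ j, j ∉ J → d j = 0) :
    WithLp.toLp 2 ((pairMatrix z * (transformMatrix m H).transpose).mulVec d)
      ∈ modelSpace H θ₀ z J := by
  have : WithLp.toLp 2 ((pairMatrix z * (transformMatrix m H).transpose).mulVec d)
      = ∑ j, d j • WithLp.toLp 2 ((pairMatrix z * (transformMatrix m H).transpose).col j) := by
    ext p
    simp [Matrix.mulVec, dotProduct, mul_comm]
  rw [this]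
  refine Submodule.sum_mem _ fun j _ => ?_
  by_cases hj : j ∈ J
  · exact Submodule.smul_mem _ _ (Submodule.subset_span (Set.mem_insert_of_mem _ ⟨j, hj, rfl⟩))
  · rw [hd j hj, zero_smul]
    exact Submodule.zero_mem _

/-- The counting bounds use the condition on `n` in this form. -/
lemma le_of_sqrt_exp_mul_cube_le {n n₀ : ℕ} (h : Real.sqrt (Real.exp 1 * (n₀ : ℝ) ^ 3) ≤ n) :
    n₀ ≤ n := by
  rcases Nat.eq_zero_or_pos n₀ with rfl | h0
  · exact Nat.zero_le _
  have h1 : (1 : ℝ) ≤ n₀ := by exact_mod_cast h0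
  have he := Real.one_le_exp (zero_le_one (α := ℝ))
  have : (n₀ : ℝ) ≤ Real.sqrt (Real.exp 1 * (n₀ : ℝ) ^ 3) := by
    refine Real.le_sqrt_of_sq_le ?_
    calc (n₀ : ℝ) ^ 2 ≤ (n₀ : ℝ) ^ 3 := pow_le_pow_right₀ h1 (by norm_num)
      _ ≤ Real.exp 1 * (n₀ : ℝ) ^ 3 := le_mul_of_one_le_left (by positivity) he
  exact_mod_cast this.trans h

/-- A balanced clustering has at least one and at most `n` classes. -/
lemma IsBalanced.one_le_and_le {m n L : ℕ} (hn : 1 ≤ n) (hL : 1 ≤ L) {α₁ α₂ : ℝ} (hα₁ : 0 < α₁)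
    {z : Clustering m n L} (hz : IsBalanced α₁ α₂ z) : 1 ≤ m ∧ m ≤ n := by
  have hm : 1 ≤ m := (Nat.zero_le _).trans_lt (z ⟨0, hL⟩ ⟨0, hn⟩).2
  refine ⟨hm, ?_⟩
  have hn' : (0 : ℝ) < n := by exact_mod_cast hn
  have hm' : (0 : ℝ) < m := by exact_mod_cast hm
  -- The lower balance bound with `α₁ > 0` forbids empty classes.
  have hsurj : Function.Surjective (z ⟨0, hL⟩) := by
    intro k
    have h := (hz ⟨0, hL⟩ k).1
    have hpos : (0 : ℝ) < classSize z ⟨0, hL⟩ k := lt_of_lt_of_le (by positivity) h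
    have hpos' : 0 < classSize z ⟨0, hL⟩ k := by exact_mod_cast hpos
    obtain ⟨i, hi⟩ := Finset.card_pos.1 hpos'
    exact ⟨i, (Finset.mem_filter.1 hi).2⟩
  simpa using Fintype.card_le_of_surjective _ hsurj

lemma IsObservation.integral_unpack {Ω : Type*} [MeasurableSpace Ω] {P : Measure Ω}
    [IsProbabilityMeasure P] {n L : ℕ} {Λ : Tensor n L} {B : Ω → Tensor n L}
    (hB : IsObservation P Λ B) (p : Fin L × NodePair n) :
    ∫ ω, unpack (B ω) p ∂P = unpack Λ p := by
  have hm : MeasurableSet {ω | B ω p.2.1.1 p.2.1.2 p.1 = 1} :=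
    hB.measurable _ _ _ (measurableSet_singleton 1)
  have : (fun ω => unpack (B ω) p)
      = Set.indicator {ω | B ω p.2.1.1 p.2.1.2 p.1 = 1} (fun _ => (1 : ℝ)) := by
    ext ω
    rcases (hB.adjacency ω).1 p.2.1.1 p.2.1.2 p.1 with h | h <;>
      simp [unpack, Set.indicator, h]
  rw [this, integral_indicator_const _ hm]
  simp [unpack, hB.prob]

/-! ### Oracle inequality and union bound -/

/-- The deterministic oracle inequality in terms of the projected noise. -/
lemma loss_le_of_isSolution {m₀ n L n₀ : ℕ} (hn : 1 ≤ n) (hL : 1 ≤ L) {α₁ α₂ : ℝ} (hα₁ : 0 < α₁)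
    (hα₂ : 0 ≤ α₂) (H : Matrix (Fin L) (Fin L) ℝ) (hH : H.transpose * H = 1)
    (hH' : H * H.transpose = 1) (z₀ : Clustering m₀ n L) (hz₀ : IsBalanced α₁ α₂ z₀)
    (Q₀ : Matrix (ClassPair m₀) (Fin L) ℝ) (𝒞 : (m : ℕ) → Set (Clustering m n L))
    (h𝒞 : z₀ ∈ 𝒞 m₀) (J : ClassPair m₀ → Finset (Fin L)) (b : Tensor n L) (e : Candidate n L)
    (he : e.IsSolution n₀ H 𝒞 b) (t : ℝ)
    (hproj : 8 * ‖(modelSpace H ((pairMatrix z₀ * (transformMatrix m₀ H).transpose).mulVec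
        (restrictedCoeff (Q₀ * H.transpose) J)) e.z e.J).starProjection
        (WithLp.toLp 2 fun p => unpack b p - unpack (probTensor z₀ Q₀) p)‖ ^ 2
      ≤ 2 * penalty n n₀ L e.J.card e.m + 19 * t) :
    loss (e.tensor H) (probTensor z₀ Q₀)
      ≤ (6 * α₂ ^ 2 / ((m₀ : ℝ) ^ 2 * L) * ∑ k, ∑ l ∈ (J k)ᶜ, (Q₀ * H.transpose) k l ^ 2
        + 4 * penalty n n₀ L (rowUnion J).card m₀ / ((n : ℝ) ^ 2 * L))
        + 38 * t / ((n : ℝ) ^ 2 * L) := by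
  obtain ⟨hm1, hmn⟩ := hz₀.one_le_and_le hn hL hα₁
  have hbias := bias_le hα₂ z₀ hz₀ Q₀ H hH hH' J
  set S := ∑ k, ∑ l ∈ (J k)ᶜ, (Q₀ * H.transpose) k l ^ 2
  set d₀ := restrictedCoeff (Q₀ * H.transpose) J with hd₀
  -- The competitor is the true clustering with the truncated true coefficients.
  have hopt := he.2 ⟨m₀, z₀, rowUnion J, d₀⟩
    ⟨hm1, hmn, h𝒞, fun j hj => by simp only [hd₀, restrictedCoeff] at *; exact if_neg hj⟩
  simp only [Candidate.objective, Candidate.theta] at hopt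
  set θ₀ := (pairMatrix z₀ * (transformMatrix m₀ H).transpose).mulVec d₀
  set θ' := (pairMatrix e.z * (transformMatrix e.m H).transpose).mulVec e.d with hθ'
  set θ := unpack (probTensor z₀ Q₀)
  have hnorm : ∀ u v : Fin L × NodePair n → ℝ,
      ‖(WithLp.toLp 2 u : EuclideanSpace ℝ (Fin L × NodePair n)) - WithLp.toLp 2 v‖ ^ 2
        = ∑ p, (u p - v p) ^ 2 := fun u v => by
    simp [EuclideanSpace.real_norm_sq_eq]
  have hmain := norm_sq_le_of_penalized (modelSpace H θ₀ e.z e.J) (WithLp.toLp 2 (unpack b))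
    (WithLp.toLp 2 θ) (WithLp.toLp 2 θ') (WithLp.toLp 2 θ₀) (penalty n n₀ L e.J.card e.m)
    (penalty n n₀ L (rowUnion J).card m₀)
    (mulVec_mem_modelSpace H θ₀ e.z e.J e.d he.1.2.2.2)
    (Submodule.subset_span (Set.mem_insert _ _))
    (by rw [hnorm, hnorm]; exact hopt)
  rw [hnorm, hnorm, ← WithLp.toLp_sub] at hmain
  have hproj' : 8 * ‖(modelSpace H θ₀ e.z e.J).starProjection
      (WithLp.toLp 2 (unpack b - θ))‖ ^ 2 ≤ 2 * penalty n n₀ L e.J.card e.m + 19 * t := hproj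
  have hn' : (0 : ℝ) < n := by exact_mod_cast hn
  have hL' : (0 : ℝ) < L := by exact_mod_cast hL
  have hm' : (0 : ℝ) < m₀ := by exact_mod_cast hm1
  have hrhs : 6 * α₂ ^ 2 / ((m₀ : ℝ) ^ 2 * L) * S
      = 6 * ((α₂ * ((n : ℝ) / m₀)) ^ 2 * S) / ((n : ℝ) ^ 2 * L) := by
    field_simp
  rw [loss, Candidate.tensor, normSq_pack_sub, Candidate.theta, ← hθ', hrhs, ← add_div, ← add_div]
  refine div_le_div_of_nonneg_right ?_ (by positivity)
  linarith

open Classical in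
/-- The noise projected on the model spaces is dominated by the penalty with high probability. -/
lemma measureReal_exists_proj_le {Ω : Type*} [MeasurableSpace Ω] (P : Measure Ω)
    [IsProbabilityMeasure P] {n L n₀ : ℕ} (hn : 1 ≤ n) (hL : 1 ≤ L) (hn₀ : n₀ ≤ n)
    (H : Matrix (Fin L) (Fin L) ℝ) {Λ : Tensor n L} {B : Ω → Tensor n L}
    (hB : IsObservation P Λ B) (θ₀ : Fin L × NodePair n → ℝ) (t : ℝ) :
    P.real (⋃ m ∈ Finset.Icc 1 n, ⋃ z ∈ Finset.univ.filter fun z : Clustering m n L =>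
        z ∈ clusterings m n n₀ L, ⋃ J ∈ (Finset.univ : Finset (Finset (Fin L × ClassPair m))),
      {ω | 2 * penalty n n₀ L J.card m + 19 * t < 8 * ‖(modelSpace H θ₀ z J).starProjection
        (WithLp.toLp 2 fun p => unpack (B ω) p - unpack Λ p)‖ ^ 2})
      ≤ 8 * Real.exp (-(57 / 16 * t)) := by
  have h01 : ∀ (p : Fin L × NodePair n) ω, unpack (B ω) p ∈ Set.Icc (0 : ℝ) 1 := by
    intro p ω
    rcases (hB.adjacency ω).1 p.2.1.1 p.2.1.2 p.1 with h | h <;> simp [unpack, h]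
  calc _ ≤ ∑ m ∈ Finset.Icc 1 n, ∑ _z ∈ Finset.univ.filter fun z : Clustering m n L =>
          z ∈ clusterings m n n₀ L, ∑ J : Finset (Fin L × ClassPair m),
          (2 : ℝ) ^ (J.card + 1) * Real.exp (-(3 / 8 * penalty n n₀ L J.card m))
            * Real.exp (-(57 / 16 * t)) := by
        refine (measureReal_biUnion_finset_le _ _).trans (Finset.sum_le_sum fun m _ => ?_)
        refine (measureReal_biUnion_finset_le _ _).trans (Finset.sum_le_sum fun z _ => ?_)
        refine (measureReal_biUnion_finset_le _ _).trans (Finset.sum_le_sum fun J _ => ?_)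
        -- With threshold `T = 2 Pen + 19 t`, the exponent `3T/16` splits into `3/8 · Pen` and
        -- `57/16 · t`.
        refine (measureReal_proj_le P (fun p ω => unpack (B ω) p) (fun p => hB.measurable _ _ _)
          h01 hB.indep (unpack Λ) hB.integral_unpack _ _ (finrank_modelSpace_le H θ₀ z J)
          _).trans (le_of_eq ?_)
        rw [mul_assoc, ← Real.exp_add]
        congr 2
        ring
    _ ≤ _ := by
        simp_rw [← Finset.sum_mul]
        gcongr
        exact sum_weights_le hn hL hn₀

end DSBM

open DSBM in
theorem theorem2 {Ω : Type*} [MeasurableSpace Ω] (P : Measure Ω) [IsProbabilityMeasure P]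
    (n L n₀ m₀ : ℕ) (hn : 1 ≤ n) (hL : 1 ≤ L)
    (hn₀ : Real.sqrt (Real.exp 1 * (n₀ : ℝ) ^ 3) ≤ n)
    (α₁ α₂ : ℝ) (hα₁ : 0 < α₁) (hα₁' : α₁ ≤ 1) (hα₂ : 1 ≤ α₂)
    (H : Matrix (Fin L) (Fin L) ℝ) (hH : H.transpose * H = 1) (hH' : H * H.transpose = 1)
    -- the true clustering, the true connection probabilities and the observed data
    (z₀ : Clustering m₀ n L) (hz₀ : z₀ ∈ balancedClusterings m₀ n n₀ L α₁ α₂)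
    (Q₀ : Matrix (ClassPair m₀) (Fin L) ℝ) (hQ₀ : ∀ k l, Q₀ k l ∈ Set.Icc (0 : ℝ) 1)
    (B : Ω → Tensor n L) (hB : IsObservation P (probTensor z₀ Q₀) B)
    -- the class of clusterings used by the estimator, and the estimator
    (𝒞 : (m : ℕ) → Set (Clustering m n L))
    (h𝒞 : ∀ m, 1 ≤ m → m ≤ n →
      balancedClusterings m n n₀ L α₁ α₂ ⊆ 𝒞 m ∧ 𝒞 m ⊆ clusterings m n n₀ L)
    (est : Tensor n L → Candidate n L)
    (hest : ∀ b : Tensor n L, IsAdjacency b → (est b).IsSolution n₀ H 𝒞 b) :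
    (∀ t : ℝ, 0 < t →
      1 - 9 * Real.exp (-t) ≤
        P.real {ω | loss ((est (B ω)).tensor H) (probTensor z₀ Q₀) ≤
          oracleBound n n₀ α₂ (Q₀ * H.transpose) + 38 * t / ((n : ℝ) ^ 2 * L)}) ∧
    Integrable (fun ω => loss ((est (B ω)).tensor H) (probTensor z₀ Q₀)) P ∧
    ∫ ω, loss ((est (B ω)).tensor H) (probTensor z₀ Q₀) ∂P ≤
      oracleBound n n₀ α₂ (Q₀ * H.transpose) + 342 / ((n : ℝ) ^ 2 * L) := by
  have hn₀' := le_of_sqrt_exp_mul_cube_le hn₀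
  have hα₂' : 0 ≤ α₂ := zero_le_one.trans hα₂
  obtain ⟨hm1, hmn⟩ := hz₀.2.one_le_and_le hn hL hα₁
  have hc : (0 : ℝ) < 38 / ((n : ℝ) ^ 2 * L) := by
    have hn' : (0 : ℝ) < n := by exact_mod_cast hn
    have hL' : (0 : ℝ) < L := by exact_mod_cast hL
    positivity
  set X : Ω → ℝ := fun ω => loss ((est (B ω)).tensor H) (probTensor z₀ Q₀)
  -- The minimising `J` is deterministic, so `θ₀` is a fixed vector and the union bound need not run
  -- over the oracle sets.
  obtain ⟨J, hJ⟩ := exists_eq_ciInf_of_finite (f := fun J : ClassPair m₀ → Finset (Fin L) =>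
    6 * α₂ ^ 2 / ((m₀ : ℝ) ^ 2 * L) * ∑ k, ∑ l ∈ (J k)ᶜ, (Q₀ * H.transpose) k l ^ 2
      + 4 * penalty n n₀ L (rowUnion J).card m₀ / ((n : ℝ) ^ 2 * L))
  rw [← oracleBound] at hJ
  set o := oracleBound n n₀ α₂ (Q₀ * H.transpose)
  have htail : ∀ t, 0 < t →
      P.real {ω | o + 38 / ((n : ℝ) ^ 2 * L) * t < X ω} ≤ 9 * Real.exp (-t) := by
    intro t ht
    refine (measureReal_mono ?_ (measure_ne_top P _)).trans
      ((measureReal_exists_proj_le P hn hL hn₀' H hB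
      ((pairMatrix z₀ * (transformMatrix m₀ H).transpose).mulVec
        (restrictedCoeff (Q₀ * H.transpose) J)) t).trans ?_)
    · classical
      intro ω hω
      have hsol := hest (B ω) (hB.adjacency ω)
      by_contra hnot
      rw [Set.mem_ofPred_eq] at hω
      refine absurd hω (not_lt.2 ?_)
      rw [← hJ, div_mul_eq_mul_div 38]
      refine loss_le_of_isSolution hn hL hα₁ hα₂' H hH hH' z₀ hz₀.2 Q₀ 𝒞
        ((h𝒞 m₀ hm1 hmn).1 hz₀) J (B ω) (est (B ω)) hsol t (not_lt.1 fun hlt => hnot ?_)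
      obtain ⟨⟨h1, h2, h3, -⟩, -⟩ := hsol
      simp only [Set.mem_iUnion]
      exact ⟨(est (B ω)).m, Finset.mem_Icc.2 ⟨h1, h2⟩, (est (B ω)).z,
        Finset.mem_filter.2 ⟨Finset.mem_univ _, (h𝒞 _ h1 h2).2 h3⟩, (est (B ω)).J,
        Finset.mem_univ _, hlt⟩
    · have : Real.exp (-(57 / 16 * t)) ≤ Real.exp (-t) := Real.exp_le_exp.2 (by linarith)
      linarith [Real.exp_pos (-t)]
  have hmeas : Measurable B :=
    measurable_pi_lambda _ fun i => measurable_pi_lambda _ fun j => measurable_pi_lambda _ fun l =>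
      hB.measurable i j l
  have hint : Integrable X P := integrable_comp_of_finite P B hmeas _ (finite_isAdjacency n L)
    hB.adjacency fun b => loss ((est b).tensor H) (probTensor z₀ Q₀)
  refine ⟨fun t ht => ?_, hint, ?_⟩
  · have hunion : P.real Set.univ ≤ P.real {ω | X ω ≤ o + 38 * t / ((n : ℝ) ^ 2 * L)}
        + P.real {ω | o + 38 / ((n : ℝ) ^ 2 * L) * t < X ω} := by
      refine (measureReal_mono ?_).trans (measureReal_union_le _ _)
      intro ω _
      rw [Set.mem_union, Set.mem_ofPred_eq, Set.mem_ofPred_eq, div_mul_eq_mul_div]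
      exact le_or_gt _ _
    rw [probReal_univ] at hunion
    linarith [htail t ht]
  -- `342 = 38 · 9`.
  · refine (integral_le_of_tail P X hint o _ 9 hc htail).trans (le_of_eq ?_)
    ring
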